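/- Let $(R,\mathfrak m)$ be a Noetherian local ring of prime characteristic $p>0$. For an ideal $J\subseteq R$ and $e\ge 0$ let $J^{[p^e]}$ be the ideal generated by $\{a^{p^e}: a\in J\}$, and let $F_R^e\colon H^i_{\mathfrak m}(R/J)\to H^i_{\mathfrak m}(R/J^{[p^e]})$ be the map induced by $R/J\to R/J^{[p^e]}$, $a+J\mapsto a^{p^e}+J^{[p^e]}$. Say that $H^i_{\mathfrak m}(R/J)$ is *$F$-nilpotent relative to $R$* if for every $\eta\in H^i_{\mathfrak m}(R/J)$ there is $e\ge 0$ with $F_R^e(\eta)=0$. Say that $J$ *satisfies condition (LC)* if there is an integer $C\ge 0$ such that $\mathfrak m^{Cp^e}\cdot H^0_{\mathfrak m}(R/J^{[p^e]})=0$ for all $e\ge 0$. An element $x\in\mathfrak m$ is *filter regular* on a finitely generated module $M$ if $x\notin P$ for every $P\in\operatorname{Ass}_R(M)\setminus\{\mathfrak m\}$. (Local cohomology is computed by the Čech complex on any finite sequence generating $\mathfrak m$ up to radical.) Let $I\subseteq R$ be an ideal, let $x$ be a filter regular element on $R/I^{[p^e]}$ for all $e\ge 0$, and let $t\ge 0$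 be an integer. 1. If $H^i_{\mathfrak m}(R/I^{[p^e]})$ is $F$-nilpotent relative to $R$ for all $i\le t$ and all $e\ge 0$, then $H^i_{\mathfrak m}(R/(I^{[p^e]},x^{p^{e'}}))$ is $F$-nilpotent relative to $R$ for all $i\le t-1$ and all $e,e'\ge 0$. 2. Conversely, if $t\ge 1$, $I$ satisfies condition (LC), and $H^i_{\mathfrak m}(R/(I^{[p^e]},x^{p^{e'}}))$ is $F$-nilpotent relative to $R$ for all $i\le t-1$ and all $e,e'\ge 0$, then $H^i_{\mathfrak m}(R/I^{[p^e]})$ is $F$-nilpotent relative to $R$ for all $i\le t$ and all $e\ge 0$. -/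

import Mathlib

noncomputable section

namespace LocCoh

universe u v w

/-! ### Localization maps `M_a → M_b` -/

section Localization

variable {R : Type u} [CommRing R] (M : Type v) [AddCommGroup M] [Module R M]

theorem isUnit_of_dvd {a b : R} (h : a ∣ b) (s : Submonoid.powers a) :
    IsUnit (algebraMap R (Module.End R (LocalizedModule (Submonoid.powers b) M)) s) := by
  obtain ⟨s, n, rfl⟩ := s
  obtain ⟨c, rfl⟩ := h
  have hb := IsLocalizedModule.map_units
    (LocalizedModule.mkLinearMap (Submonoid.powers (a * c)) M)
    ⟨a * c, Submonoid.mem_powers _⟩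
  have hcomm : Commute (algebraMap R (Module.End R (LocalizedModule (Submonoid.powers (a * c)) M)) a)
      (algebraMap R _ c) := Algebra.commutes a _
  simp only [map_mul] at hb
  simpa using ((hcomm.isUnit_mul_iff.1 hb).1).pow n

/-- The canonical map `M_a → M_b`, `m / 1 ↦ m / 1`, for `a ∣ b`. -/
def res {a b : R} (h : a ∣ b) :
    LocalizedModule (Submonoid.powers a) M →ₗ[R] LocalizedModule (Submonoid.powers b) M :=
  LocalizedModule.lift (Submonoid.powers a)
    (LocalizedModule.mkLinearMap (Submonoid.powers b) M) (isUnit_of_dvd M h)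

theorem res_comp_mk {a b : R} (h : a ∣ b) :
    (res M h).comp (LocalizedModule.mkLinearMap (Submonoid.powers a) M) =
      LocalizedModule.mkLinearMap (Submonoid.powers b) M :=
  LocalizedModule.lift_comp _ _ _

theorem res_comp_res {a b c : R} (h : a ∣ b) (h' : b ∣ c) :
    (res M h').comp (res M h) = res M (h.trans h') := by
  apply IsLocalizedModule.ext (Submonoid.powers a)
    (LocalizedModule.mkLinearMap (Submonoid.powers a) M) (isUnit_of_dvd M (h.trans h'))
  rw [LinearMap.comp_assoc, res_comp_mk, res_comp_mk, res_comp_mk]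

variable {M}
variable {N : Type w} [AddCommGroup N] [Module R N] {φ : R →+* R}

/-- For a ring endomorphism `φ` with `φ a ∈ {1, a, a², …}` and a `φ`-semilinear map `f : M → N`,
the induced map `M_a → N_a`, `m / s ↦ f m / φ s`. -/
def locMap (f : M →ₛₗ[φ] N) {a : R} (ha : φ a ∈ Submonoid.powers a) :
    LocalizedModule (Submonoid.powers a) M →ₛₗ[φ] LocalizedModule (Submonoid.powers a) N :=
  have hs : ∀ s ∈ Submonoid.powers a, φ s ∈ Submonoid.powers a := by
    rintro _ ⟨n, rfl⟩
    simpa using Submonoid.pow_mem _ ha n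
  { toFun := fun z => z.liftOn
      (fun q => LocalizedModule.mk (f q.1) ⟨φ q.2, hs _ q.2.2⟩) (by
        rintro ⟨m, s⟩ ⟨m', s'⟩ ⟨t, ht⟩
        refine LocalizedModule.mk_eq.2 ⟨⟨φ t, hs _ t.2⟩, ?_⟩
        have := congrArg f ht
        simpa [Submonoid.smul_def] using this)
    map_add' := by
      intro z z'
      induction z using LocalizedModule.induction_on with | h m s => ?_
      induction z' using LocalizedModule.induction_on with | h m' s' => ?_
      simp only [LocalizedModule.mk_add_mk, LocalizedModule.liftOn_mk]
      congr 1
      · simp [Submonoid.smul_def]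
      · ext; simp
    map_smul' := by
      intro r z
      induction z using LocalizedModule.induction_on with | h m s => ?_
      simp only [LocalizedModule.smul'_mk, LocalizedModule.liftOn_mk, map_smulₛₗ] }

theorem locMap_mk (f : M →ₛₗ[φ] N) {a : R} (ha : φ a ∈ Submonoid.powers a) (m : M)
    (s : Submonoid.powers a) (hs : φ s ∈ Submonoid.powers a) :
    locMap f ha (LocalizedModule.mk m s) = LocalizedModule.mk (f m) ⟨φ s, hs⟩ := rfl

theorem res_locMap (f : M →ₛₗ[φ] N) {a b : R} (h : a ∣ b)
    (ha : φ a ∈ Submonoid.powers a) (hb : φ b ∈ Submonoid.powers b)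
    (z : LocalizedModule (Submonoid.powers a) M) :
    locMap f hb (res M h z) = res N h (locMap f ha z) := by
  induction z using LocalizedModule.induction_on with | h m s => ?_
  have hs : φ s ∈ Submonoid.powers a := by
    obtain ⟨_, n, rfl⟩ := s
    simpa using Submonoid.pow_mem _ ha n
  have hu := isUnit_of_dvd N h ⟨φ s, hs⟩
  apply ((Module.End.isUnit_iff _).1 hu).1
  simp only [Module.algebraMap_end_apply]
  rw [← map_smulₛₗ (locMap f hb), ← map_smul (res M h), ← map_smul (res N h), locMap_mk f ha m s hs]
  have h1 : (s : R) • LocalizedModule.mk m s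
      = LocalizedModule.mkLinearMap (Submonoid.powers a) M m := by
    rw [LocalizedModule.smul'_mk, ← Submonoid.smul_def, LocalizedModule.mk_cancel]; rfl
  have h2 : φ s • LocalizedModule.mk (f m) (⟨φ s, hs⟩ : Submonoid.powers a)
      = LocalizedModule.mkLinearMap (Submonoid.powers a) N (f m) := by
    rw [LocalizedModule.smul'_mk]
    exact LocalizedModule.mk_cancel (⟨φ s, hs⟩ : Submonoid.powers a) (f m)
  have h3 := LinearMap.congr_fun (res_comp_mk M h) m
  have h4 := LinearMap.congr_fun (res_comp_mk N h) (f m)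
  rw [LinearMap.comp_apply] at h3 h4
  rw [h1, h2, h3, h4]
  simp only [LocalizedModule.mkLinearMap_apply]
  rw [locMap_mk f hb m 1 (by simp)]
  congr 1
  ext; simp

end Localization

/-! ### The Čech complex and its cohomology -/

section Cech

variable {R : Type u} [CommRing R] {n : ℕ} (y : Fin n → R)

/-- The product `∏_{j ∈ σ} y_j`. -/
def prodOn (σ : Finset (Fin n)) : R := ∏ j ∈ σ, y j

theorem prodOn_dvd {σ τ : Finset (Fin n)} (h : σ ⊆ τ) : prodOn y σ ∣ prodOn y τ :=
  Finset.prod_dvd_prod_of_subset _ _ _ h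

/-- The `k`-subsets of `{0, …, n - 1}`. -/
abbrev Sub (n k : ℕ) : Type := {σ : Finset (Fin n) // σ.card = k}

/-- The `k`-subset obtained from a `(k + 1)`-subset `τ` by omitting `j ∈ τ`. -/
def face {k : ℕ} (τ : Sub n (k + 1)) (j : τ.1) : Sub n k :=
  ⟨τ.1.erase j, by rw [Finset.card_erase_of_mem j.2, τ.2]; rfl⟩

theorem face_subset {k : ℕ} (τ : Sub n (k + 1)) (j : τ.1) : (face τ j).1 ⊆ τ.1 :=
  Finset.erase_subset _ _

/-- The sign `(-1)^{#{l ∈ τ : l < j}}`, i.e. `(-1)^i` when `j` is the `i`-th element of `τ`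
(counted from `0`). -/
def sgn (R : Type u) [CommRing R] (τ : Finset (Fin n)) (j : Fin n) : R := (-1) ^ (τ.filter (· < j)).card

variable (M : Type v) [AddCommGroup M] [Module R M]

/-- The Čech cochains `C^k(y; M) = ⨁_{j_1 < ⋯ < j_k} M_{y_{j_1} ⋯ y_{j_k}}`. -/
abbrev Cochain (k : ℕ) : Type (max u v) :=
  ∀ σ : Sub n k, LocalizedModule (Submonoid.powers (prodOn y σ.1)) M

/-- The Čech differential `C^k(y; M) → C^{k+1}(y; M)`: the alternating sum of the localization
maps. -/
def d (k : ℕ) : Cochain y M k →ₗ[R] Cochain y M (k + 1) :=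
  LinearMap.pi fun τ => ∑ j : τ.1,
    sgn R τ.1 j • (res M (prodOn_dvd y (face_subset τ j))).comp (LinearMap.proj (face τ j))

theorem d_apply (k : ℕ) (c : Cochain y M k) (τ : Sub n (k + 1)) :
    d y M k c τ = ∑ j : τ.1, sgn R τ.1 j • res M (prodOn_dvd y (face_subset τ j)) (c (face τ j)) := by
  simp only [d, LinearMap.pi_apply, LinearMap.sum_apply, LinearMap.smul_apply,
    LinearMap.comp_apply, LinearMap.proj_apply]

theorem sgn_erase_mul {τ : Finset (Fin n)} {i j : Fin n} (hi : i ∈ τ) (hij : i < j) :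
    sgn R τ j * sgn R (τ.erase j) i = - (sgn R τ i * sgn R (τ.erase i) j) := by
  have h1 : (τ.erase j).filter (· < i) = τ.filter (· < i) := by
    ext l; simp only [Finset.mem_filter, Finset.mem_erase]
    exact ⟨fun h => ⟨h.1.2, h.2⟩, fun h => ⟨⟨(h.2.trans hij).ne, h.1⟩, h.2⟩⟩
  have h2 : (τ.erase i).filter (· < j) = (τ.filter (· < j)).erase i := by
    ext l; simp only [Finset.mem_filter, Finset.mem_erase, and_assoc]
  have hm : i ∈ τ.filter (· < j) := by simp [hi, hij]
  have h3 : (τ.filter (· < j)).card = ((τ.filter (· < j)).erase i).card + 1 :=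
    (Finset.card_erase_add_one hm).symm
  rw [sgn, sgn, sgn, sgn, h1, h2, h3, pow_succ]
  ring

theorem d_comp_d (k : ℕ) : (d y M (k + 1)).comp (d y M k) = 0 := by
  refine LinearMap.ext fun c => ?_
  funext τ
  simp only [LinearMap.comp_apply, LinearMap.zero_apply, Pi.zero_apply]
  rw [d_apply]
  simp only [d_apply, map_sum, map_smul, Finset.smul_sum, smul_smul]
  rw [Finset.sum_sigma' Finset.univ (fun _ => Finset.univ), Finset.univ_sigma_univ]
  have key : ∀ q : (j : τ.1) × (face τ j).1, q.2.1 ∈ τ.1 ∧ q.2.1 ≠ q.1.1 := fun q =>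
    ⟨Finset.mem_of_mem_erase q.2.2, Finset.ne_of_mem_erase q.2.2⟩
  have cong : ∀ (σ σ' : Sub n k) (h : σ = σ') (h1 : σ.1 ⊆ τ.1) (h2 : σ'.1 ⊆ τ.1),
      res M (prodOn_dvd y h1) (c σ) = res M (prodOn_dvd y h2) (c σ') := by
    rintro σ _ rfl _ _; rfl
  refine Finset.sum_involution
    (fun q _ => ⟨⟨q.2.1, (key q).1⟩, ⟨q.1.1, Finset.mem_erase.2 ⟨(key q).2.symm, q.1.2⟩⟩⟩)
    ?_ ?_ (fun _ _ => Finset.mem_univ _) (fun _ _ => rfl)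
  · rintro ⟨⟨j, hj⟩, ⟨i, hi⟩⟩ -
    obtain ⟨hij, hi'⟩ := Finset.mem_erase.1 hi
    simp only [← LinearMap.comp_apply, res_comp_res]
    have hf : face (face τ ⟨j, hj⟩) ⟨i, hi⟩
        = face (face τ ⟨i, hi'⟩) ⟨j, Finset.mem_erase.2 ⟨hij.symm, hj⟩⟩ :=
      Subtype.ext Finset.erase_right_comm
    rw [cong _ _ hf ((face_subset _ _).trans (face_subset _ _))
      ((face_subset _ _).trans (face_subset _ _)), ← add_smul]
    have hs : sgn R τ.1 j * sgn R (face τ ⟨j, hj⟩).1 i + sgn R τ.1 i * sgn R (face τ ⟨i, hi'⟩).1 j = 0 := by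
      rcases lt_or_gt_of_ne hij with h | h
      · simp only [face]; rw [sgn_erase_mul (R := R) hi' h]; ring
      · simp only [face]; rw [sgn_erase_mul (R := R) hj h]; ring
    rw [hs, zero_smul]
  · rintro ⟨⟨j, hj⟩, ⟨i, hi⟩⟩ - - h
    exact (Finset.mem_erase.1 hi).1 (congrArg (fun q => q.1.1) h)

/-- The Čech cocycles of degree `k`. -/
def cocycles (k : ℕ) : Submodule R (Cochain y M k) := LinearMap.ker (d y M k)

/-- The Čech coboundaries of degree `k`. -/
def coboundaries : (k : ℕ) → Submodule R (Cochain y M k)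
  | 0 => ⊥
  | k + 1 => LinearMap.range (d y M k)

theorem coboundaries_le (k : ℕ) : coboundaries y M k ≤ cocycles y M k := by
  cases k with
  | zero => exact bot_le
  | succ k =>
    rintro _ ⟨c, rfl⟩
    exact LinearMap.congr_fun (d_comp_d y M k) c

/-- The `k`-th cohomology of the Čech complex `C^•(y; M)`. Over a Noetherian ring this is the local
cohomology module `H^k_K(M)`, for any ideal `K` with the same radical as `(y_0, …, y_{n-1})`. -/
abbrev H (k : ℕ) : Type (max u v) :=
  cocycles y M k ⧸ (coboundaries y M k).submoduleOf (cocycles y M k)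

variable {M}
variable {N : Type w} [AddCommGroup N] [Module R N] {φ : R →+* R}

/-- The map of Čech cochains `C^k(y; M) → C^k(y; N)` induced by a `φ`-semilinear map `f : M → N`,
where `φ` sends every `a ∈ R` to a power of `a`. -/
def cochainMap (f : M →ₛₗ[φ] N) (hφ : ∀ a, φ a ∈ Submonoid.powers a) (k : ℕ) :
    Cochain y M k →ₛₗ[φ] Cochain y N k where
  toFun c σ := locMap f (hφ _) (c σ)
  map_add' c c' := by funext σ; simp
  map_smul' r c := by funext σ; simp

theorem cochainMap_d (f : M →ₛₗ[φ] N) (hφ : ∀ a, φ a ∈ Submonoid.powers a) (k : ℕ)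
    (c : Cochain y M k) :
    cochainMap y f hφ (k + 1) (d y M k c) = d y N k (cochainMap y f hφ k c) := by
  funext τ
  simp only [cochainMap, LinearMap.coe_mk, AddHom.coe_mk, d_apply, map_sum, map_smulₛₗ]
  exact Finset.sum_congr rfl fun j _ => by
    rw [res_locMap f _ (hφ _)]; simp [sgn]

theorem cochainMap_mem_cocycles (f : M →ₛₗ[φ] N) (hφ : ∀ a, φ a ∈ Submonoid.powers a) (k : ℕ)
    (c : cocycles y M k) : cochainMap y f hφ k c ∈ cocycles y N k := by
  have hc : d y M k c = 0 := c.2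
  change d y N k _ = 0
  rw [← cochainMap_d, hc, map_zero]

/-- The induced map on Čech cocycles. -/
def cocyclesMap (f : M →ₛₗ[φ] N) (hφ : ∀ a, φ a ∈ Submonoid.powers a) (k : ℕ) :
    cocycles y M k →ₛₗ[φ] cocycles y N k :=
  LinearMap.codRestrict _ ((cochainMap y f hφ k).comp (cocycles y M k).subtype)
    (cochainMap_mem_cocycles y f hφ k)

theorem cocyclesMap_coboundaries (f : M →ₛₗ[φ] N) (hφ : ∀ a, φ a ∈ Submonoid.powers a) (k : ℕ) :
    (coboundaries y M k).submoduleOf (cocycles y M k) ≤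
      ((coboundaries y N k).submoduleOf (cocycles y N k)).comap (cocyclesMap y f hφ k) := by
  intro c hc
  change cochainMap y f hφ k c ∈ coboundaries y N k
  change (c : Cochain y M k) ∈ coboundaries y M k at hc
  cases k with
  | zero =>
    have h0 : (c : Cochain y M 0) = 0 := hc
    rw [h0, map_zero]; exact Submodule.zero_mem _
  | succ k =>
    obtain ⟨b, hb⟩ := hc
    rw [← hb, cochainMap_d]
    exact ⟨_, rfl⟩

/-- The map `H^k(y; M) → H^k(y; N)` induced by a `φ`-semilinear map `f : M → N`. -/
def HMap (f : M →ₛₗ[φ] N) (hφ : ∀ a, φ a ∈ Submonoid.powers a) (k : ℕ) :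
    H y M k →ₛₗ[φ] H y N k :=
  Submodule.mapQ _ _ (cocyclesMap y f hφ k) (cocyclesMap_coboundaries y f hφ k)

end Cech

/-! ### Frobenius -/

section Frobenius

variable {R : Type u} [CommRing R] (p : ℕ) [Fact p.Prime] [CharP R p]

/-- The Frobenius power `I^{[p^e]}`, generated by the elements `a^{p^e}`, `a ∈ I`. -/
def frobPow (I : Ideal R) (e : ℕ) : Ideal R := I.map (iterateFrobenius R p e)

/-- The relative Frobenius map `F_R^e : R/I → R/I^{[p^e]}`, `a + I ↦ a^{p^e} + I^{[p^e]}`. -/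
def relFrob (I : Ideal R) (e : ℕ) : (R ⧸ I) →ₛₗ[iterateFrobenius R p e] (R ⧸ frobPow p I e) :=
  Submodule.mapQ I (frobPow p I e) (iterateFrobenius R p e).toSemilinearMap
    fun _ ha => Ideal.mem_map_of_mem _ ha

theorem relFrob_mk (I : Ideal R) (e : ℕ) (a : R) :
    relFrob p I e (Ideal.Quotient.mk I a) = Ideal.Quotient.mk (frobPow p I e) (a ^ p ^ e) := rfl

theorem iterateFrobenius_mem_powers (e : ℕ) (a : R) :
    iterateFrobenius R p e a ∈ Submonoid.powers a :=
  ⟨p ^ e, rfl⟩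

variable {n : ℕ} (y : Fin n → R)

/-- The map `F_R^e : H^i_K(R/I) → H^i_K(R/I^{[p^e]})` induced by `F_R^e : R/I → R/I^{[p^e]}`, where
`K` is an ideal with the same radical as `(y_0, …, y_{n-1})`. -/
def relFrobH (I : Ideal R) (e i : ℕ) :
    H y (R ⧸ I) i →ₛₗ[iterateFrobenius R p e] H y (R ⧸ frobPow p I e) i :=
  HMap y (relFrob p I e) (iterateFrobenius_mem_powers p e) i

/-- `H^i_K(R/I)` is `F`-nilpotent with respect to `R`: each of its elements is killed by some
`F_R^e : H^i_K(R/I) → H^i_K(R/I^{[p^e]})`. -/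
def IsFNilpotentRel (I : Ideal R) (i : ℕ) : Prop :=
  ∀ η : H y (R ⧸ I) i, ∃ e : ℕ, relFrobH p y I e i η = 0

variable [IsLocalRing R]

/-- The condition (LC) on `I`: there is `C` with `𝔪^{C p^e} · H^0_𝔪(R/I^{[p^e]}) = 0` for all `e`
(for `y` generating `𝔪` up to radical). -/
def SatisfiesLC (I : Ideal R) : Prop :=
  ∃ C : ℕ, ∀ e : ℕ, ∀ a ∈ IsLocalRing.maximalIdeal R ^ (C * p ^ e),
    ∀ η : H y (R ⧸ frobPow p I e) 0, a • η = 0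

end Frobenius

/-- `x` is a filter regular element on `M`. -/
def IsFilterRegular {R : Type u} [CommRing R] [IsLocalRing R] (x : R)
    (M : Type v) [AddCommGroup M] [Module R M] : Prop :=
  x ∈ IsLocalRing.maximalIdeal R ∧
    ∀ P ∈ associatedPrimes R M, P ≠ IsLocalRing.maximalIdeal R → x ∉ P

end LocCoh

end

noncomputable section

namespace LocCoh

universe u v w

/-! ### Kernel and cokernel of the localization maps `M_a → M_{ac}`. -/

section Localization

variable {R : Type u} [CommRing R] {M : Type v} [AddCommGroup M] [Module R M]
  {N : Type w} [AddCommGroup N] [Module R N]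

/-! Filter regularity makes the annihilator of `x` in `R/I^{[p^e]}` an `𝔪`-power torsion module,
which dies once some `y_j` is inverted. So `x` acts injectively on Čech cochains of positive degree
(`isCechRegular_of_isFilterRegular`), and with `u` a power of `x` and `J` a Frobenius power of `I`,
multiplication by `u` on `R/J` yields the usual connecting maps `H^i(R/(J,u)) → H^{i+1}(R/J)`.
Frobenius turns `db = ua` into `dF^e(b) = u^{p^e}F^e(a)`, so the diagram chases can be run on
cochains.

Statement 1 is the chase through `H^i(R/J) → H^i(R/(J,u)) → H^{i+1}(R/J)`
(`IsFNilpotentRel.sup_span_singleton`). For statement 2 in positive degree, each class is killed by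
some `u = x^{p^N}`, hence comes from `H^i(R/(J,u))`, where it is nilpotent
(`isFNilpotentRel_succ_of_sup_span_singleton`). Degree 0 has no connecting map into it; there (LC)
annihilates what remains (`isFNilpotentRel_zero_of_sup_span_singleton`). -/

theorem localizedModule_mk_eq_zero {S : Submonoid R} {m : M} {s : S} :
    LocalizedModule.mk m s = 0 ↔ ∃ u ∈ S, u • m = 0 := by
  rw [← LocalizedModule.zero_mk (1 : S), LocalizedModule.mk_eq]
  constructor
  · rintro ⟨u, hu⟩
    exact ⟨u, u.2, by simpa [Submonoid.smul_def] using hu⟩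
  · rintro ⟨u, hu, h⟩
    exact ⟨⟨u, hu⟩, by simpa [Submonoid.smul_def] using h⟩

theorem smul_localizedModule_mk_self {S : Submonoid R} (m : M) (s : S) :
    (s : R) • LocalizedModule.mk m s = LocalizedModule.mk m 1 := by
  rw [LocalizedModule.smul'_mk, ← Submonoid.smul_def, LocalizedModule.mk_cancel]

theorem res_mk_one {a b : R} (h : a ∣ b) (m : M) :
    res M h (LocalizedModule.mk m 1) = LocalizedModule.mk m 1 :=
  LinearMap.congr_fun (res_comp_mk M h) m

theorem exists_pow_smul_eq_zero_of_res_eq_zero {a b c : R} (hb : b = a * c) (h : a ∣ b)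
    (z : LocalizedModule (Submonoid.powers a) M) (hz : res M h z = 0) :
    ∃ k : ℕ, c ^ k • z = 0 := by
  induction z using LocalizedModule.induction_on with | h m s => ?_
  have h1 : res M h (LocalizedModule.mk m 1) = 0 := by
    rw [← smul_localizedModule_mk_self m s, map_smul, hz, smul_zero]
  rw [res_mk_one, localizedModule_mk_eq_zero] at h1
  obtain ⟨_, ⟨k, rfl⟩, hk⟩ := h1
  refine ⟨k, ?_⟩
  rw [LocalizedModule.smul'_mk, localizedModule_mk_eq_zero]
  refine ⟨a ^ k, ⟨k, rfl⟩, ?_⟩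
  rw [smul_smul, ← mul_pow, ← hb]
  exact hk

theorem exists_res_eq_pow_smul {a b c : R} (hb : b = a * c) (h : a ∣ b)
    (w : LocalizedModule (Submonoid.powers b) M) :
    ∃ (k : ℕ) (z : LocalizedModule (Submonoid.powers a) M), res M h z = c ^ k • w := by
  induction w using LocalizedModule.induction_on with | h m s => ?_
  obtain ⟨_, k, rfl⟩ := s
  refine ⟨k, LocalizedModule.mk m ⟨a ^ k, k, rfl⟩, ?_⟩
  have hu := isUnit_of_dvd M h ⟨a ^ k, k, rfl⟩
  apply ((Module.End.isUnit_iff _).1 hu).1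
  simp only [Module.algebraMap_end_apply]
  have h1 := smul_localizedModule_mk_self m (⟨a ^ k, k, rfl⟩ : Submonoid.powers a)
  have h2 := smul_localizedModule_mk_self m (⟨b ^ k, k, rfl⟩ : Submonoid.powers b)
  dsimp only at h1 h2 ⊢
  rw [← map_smul, h1, res_mk_one, smul_smul, ← mul_pow, ← hb]
  exact h2.symm

end Localization

/-! ### Čech cochains: exactness, injectivity of `x`, torsion of cohomology. -/

section Cech

variable {R : Type u} [CommRing R] {n : ℕ} (y : Fin n → R)
variable {M : Type v} [AddCommGroup M] [Module R M] {N : Type w} [AddCommGroup N] [Module R N]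

theorem self_mem_powers (a : R) : RingHom.id R a ∈ Submonoid.powers a :=
  Submonoid.mem_powers a

/-- The map of Čech cochains induced by a linear map. -/
def linCochainMap (f : M →ₗ[R] N) (k : ℕ) : Cochain y M k →ₗ[R] Cochain y N k :=
  cochainMap y f self_mem_powers k

theorem linCochainMap_d (f : M →ₗ[R] N) (k : ℕ) (c : Cochain y M k) :
    linCochainMap y f (k + 1) (d y M k c) = d y N k (linCochainMap y f k c) :=
  cochainMap_d y f self_mem_powers k c

theorem cochainMap_mem_coboundaries {φ : R →+* R} (f : M →ₛₗ[φ] N)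
    (hφ : ∀ a, φ a ∈ Submonoid.powers a) (k : ℕ) {c : Cochain y M k}
    (hc : c ∈ coboundaries y M k) : cochainMap y f hφ k c ∈ coboundaries y N k :=
  cocyclesMap_coboundaries y f hφ k (x := ⟨c, coboundaries_le y M k hc⟩) hc

theorem linCochainMap_surjective (f : M →ₗ[R] N) (hf : Function.Surjective f) (k : ℕ) :
    Function.Surjective (linCochainMap y f k) := by
  intro c
  have : ∀ σ, ∃ z, locMap f (self_mem_powers (prodOn y σ.1)) z = c σ := by
    intro σ
    induction c σ using LocalizedModule.induction_on with | h m s => ?_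
    obtain ⟨m, rfl⟩ := hf m
    exact ⟨LocalizedModule.mk m s, rfl⟩
  choose b hb using this
  exact ⟨b, funext hb⟩

theorem exists_eq_smul_of_linCochainMap_eq_zero (f : M →ₗ[R] N) (x : R)
    (hf : ∀ m, f m = 0 → ∃ m', m = x • m') (k : ℕ) (c : Cochain y M k)
    (hc : linCochainMap y f k c = 0) : ∃ a, c = x • a := by
  have : ∀ σ, ∃ z, c σ = x • z := by
    intro σ
    have h := congrFun hc σ
    change locMap f (self_mem_powers (prodOn y σ.1)) (c σ) = 0 at h
    induction hm : c σ using LocalizedModule.induction_on with | h m s => ?_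
    rw [hm, locMap_mk f _ m s s.2, localizedModule_mk_eq_zero] at h
    obtain ⟨u, hu, h⟩ := h
    rw [← map_smul] at h
    obtain ⟨m', hm'⟩ := hf _ h
    refine ⟨LocalizedModule.mk m' (⟨u, hu⟩ * s), ?_⟩
    rw [LocalizedModule.smul'_mk, ← hm']
    exact (LocalizedModule.mk_cancel_common_left (⟨u, hu⟩ : Submonoid.powers _) s m).symm
  choose b hb using this
  exact ⟨b, funext hb⟩

/-- A nonempty `σ` inverts some `y_j`, and a power of `y_j` kills any given element annihilated by
`x`. Degree 0 is excluded: its only component is essentially `M`, where that torsion survives. -/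
theorem cochain_smul_injective (x : R)
    (hx : ∀ m : M, x • m = 0 → ∀ j, ∃ N : ℕ, y j ^ N • m = 0) (k : ℕ) (c : Cochain y M (k + 1))
    (hc : x • c = 0) : c = 0 := by
  funext σ
  have h : x • c σ = 0 := congrFun hc σ
  rw [Pi.zero_apply]
  induction hm : c σ using LocalizedModule.induction_on with | h m s => ?_
  rw [hm, LocalizedModule.smul'_mk, localizedModule_mk_eq_zero] at h
  obtain ⟨u, ⟨r, rfl⟩, h⟩ := h
  rw [smul_comm] at h
  obtain ⟨j, hj⟩ : σ.1.Nonempty := by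
    rw [← Finset.card_pos, σ.2]; omega
  obtain ⟨N, hN⟩ := hx _ h j
  rw [localizedModule_mk_eq_zero]
  obtain ⟨e, he⟩ : y j ∣ prodOn y σ.1 := Finset.dvd_prod_of_mem y hj
  refine ⟨prodOn y σ.1 ^ (N + r), ⟨_, rfl⟩, ?_⟩
  rw [pow_add, mul_smul]
  nth_rw 1 [he]
  rw [mul_pow, mul_comm, mul_smul]
  dsimp only at hN
  rw [hN, smul_zero]

theorem prodOn_eq_prodOn_erase_mul {τ : Finset (Fin n)} {j : Fin n} (hj : j ∈ τ) :
    prodOn y τ = prodOn y (τ.erase j) * y j :=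
  (Finset.prod_erase_mul τ y hj).symm

theorem sgn_smul_eq_zero_iff (τ : Finset (Fin n)) (j : Fin n) (m : M) :
    sgn R τ j • m = 0 ↔ m = 0 := by
  rcases neg_one_pow_eq_or R (τ.filter (· < j)).card with h | h <;> simp [sgn, h]

theorem sgn_mul_self (τ : Finset (Fin n)) (j : Fin n) : sgn R τ j * sgn R τ j = 1 := by
  rcases neg_one_pow_eq_or R (τ.filter (· < j)).card with h | h <;> simp [sgn, h]

/-- A cochain supported on the sets not containing `j` has differential at `τ ∋ j` given by a single
term. -/
theorem d_apply_of_support (j : Fin n) (k : ℕ) (c : Cochain y M k)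
    (hc : ∀ σ : Sub n k, j ∈ σ.1 → c σ = 0) (τ : Sub n (k + 1)) (hj : j ∈ τ.1) :
    d y M k c τ = sgn R τ.1 j • res M (prodOn_dvd y (face_subset τ ⟨j, hj⟩)) (c (face τ ⟨j, hj⟩)) := by
  rw [d_apply]
  refine Finset.sum_eq_single_of_mem (⟨j, hj⟩ : τ.1) (Finset.mem_univ _) fun l _ hl => ?_
  rw [hc (face τ l), map_zero, smul_zero]
  exact Finset.mem_erase.2 ⟨fun h => hl (Subtype.ext h.symm), hj⟩

/-- A cocycle supported on the sets not containing `j` is killed by a power of `y j`. -/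
theorem exists_pow_smul_eq_zero_of_support (j : Fin n) (k : ℕ) (c : Cochain y M k)
    (hc : ∀ σ : Sub n k, j ∈ σ.1 → c σ = 0) (hd : d y M k c = 0) :
    ∃ N : ℕ, y j ^ N • c = 0 := by
  have : ∀ σ : Sub n k, ∃ N : ℕ, y j ^ N • c σ = 0 := by
    intro σ
    by_cases hj : j ∈ σ.1
    · exact ⟨0, by rw [hc σ hj, smul_zero]⟩
    · let τ : Sub n (k + 1) := ⟨insert j σ.1, by rw [Finset.card_insert_of_notMem hj, σ.2]⟩
      have hjτ : j ∈ τ.1 := Finset.mem_insert_self _ _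
      have hf : face τ ⟨j, hjτ⟩ = σ := Subtype.ext (Finset.erase_insert hj)
      have h := d_apply_of_support y j k c hc τ hjτ
      rw [hd, Pi.zero_apply, eq_comm, sgn_smul_eq_zero_iff] at h
      have key : ∀ ρ, face τ ⟨j, hjτ⟩ = ρ → ∃ N : ℕ, y j ^ N • c ρ = 0 := by
        rintro _ rfl
        exact exists_pow_smul_eq_zero_of_res_eq_zero (prodOn_eq_prodOn_erase_mul y hjτ) _ _ h
      exact key σ hf
  choose N hN using this
  refine ⟨∑ σ, N σ, funext fun σ => ?_⟩
  obtain ⟨r, hr⟩ := Nat.exists_eq_add_of_le (Finset.single_le_sum (f := N) (fun _ _ => Nat.zero_le _)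
    (Finset.mem_univ σ))
  rw [Pi.smul_apply, hr, pow_add, mul_comm, mul_smul, hN, smul_zero, Pi.zero_apply]

/-- Positive-degree Čech cohomology is `y j`-power torsion. -/
theorem exists_pow_smul_mem_coboundaries (j : Fin n) (k : ℕ) (c : Cochain y M (k + 1))
    (hc : d y M (k + 1) c = 0) : ∃ N : ℕ, y j ^ N • c ∈ coboundaries y M (k + 1) := by
  have hex : ∀ τ : {τ : Sub n (k + 1) // j ∈ τ.1}, ∃ (r : ℕ)
      (z : LocalizedModule (Submonoid.powers (prodOn y (face τ.1 ⟨j, τ.2⟩).1)) M),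
      res M (prodOn_dvd y (face_subset τ.1 ⟨j, τ.2⟩)) z = y j ^ r • c τ.1 := fun τ =>
    exists_res_eq_pow_smul (prodOn_eq_prodOn_erase_mul y τ.2) _ _
  choose r z hz using hex
  set N := ∑ τ, r τ with hN
  -- A contracting homotopy up to a power of `y j`: the component at `σ ∌ j` comes from that of `c`
  -- at `σ ∪ {j}`, the only `τ ∋ j` whose face omitting `j` is `σ`.
  have hex' : ∀ σ : Sub n k, ∃ b : LocalizedModule (Submonoid.powers (prodOn y σ.1)) M,
      (j ∈ σ.1 → b = 0) ∧ ∀ (τ : Sub n (k + 1)) (hj : j ∈ τ.1) (h : face τ ⟨j, hj⟩ = σ)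
        (hs : σ.1 ⊆ τ.1), sgn R τ.1 j • res M (prodOn_dvd y hs) b = y j ^ N • c τ := by
    intro σ
    by_cases hj : j ∈ σ.1
    · refine ⟨0, fun _ => rfl, fun τ hjτ h => ?_⟩
      exact absurd rfl (Finset.mem_erase.1 (h ▸ hj : j ∈ (face τ ⟨j, hjτ⟩).1)).1
    · let τ : Sub n (k + 1) := ⟨insert j σ.1, by rw [Finset.card_insert_of_notMem hj, σ.2]⟩
      have hjτ : j ∈ τ.1 := Finset.mem_insert_self _ _
      have hf : face τ ⟨j, hjτ⟩ = σ := Subtype.ext (Finset.erase_insert hj)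
      have key : ∀ (ρ : Sub n k) (_ : face τ ⟨j, hjτ⟩ = ρ),
          ∃ b : LocalizedModule (Submonoid.powers (prodOn y ρ.1)) M, ∀ hs : ρ.1 ⊆ τ.1,
            sgn R τ.1 j • res M (prodOn_dvd y hs) b = y j ^ N • c τ := by
        rintro _ rfl
        obtain ⟨s, hs⟩ := Nat.exists_eq_add_of_le (Finset.single_le_sum (f := r)
          (fun _ _ => Nat.zero_le _) (Finset.mem_univ (⟨τ, hjτ⟩ : {τ : Sub n (k + 1) // j ∈ τ.1})))
        refine ⟨sgn R τ.1 j • y j ^ s • z ⟨τ, hjτ⟩, fun h => ?_⟩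
        rw [map_smul, smul_smul, sgn_mul_self, one_smul, map_smul, hz ⟨τ, hjτ⟩, smul_smul, hN, hs,
          pow_add, mul_comm]
      obtain ⟨b, hb⟩ := key σ hf
      refine ⟨b, fun h => absurd h hj, fun τ' hjτ' h hs => ?_⟩
      have : τ' = τ := by
        apply Subtype.ext
        change τ'.1 = insert j σ.1
        rw [← h]
        exact (Finset.insert_erase hjτ').symm
      subst this
      exact hb hs
  choose b hb0 hb using hex'
  -- What is left is a cocycle supported off `j`, so a further power of `y j` kills it.
  have hsupp : ∀ σ : Sub n (k + 1), j ∈ σ.1 → (y j ^ N • c - d y M k b) σ = 0 := by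
    intro τ hj
    rw [Pi.sub_apply, Pi.smul_apply, d_apply_of_support y j k b hb0 τ hj, hb _ τ hj rfl (face_subset _ _), sub_self]
  obtain ⟨s, hs⟩ := exists_pow_smul_eq_zero_of_support y j (k + 1) _ hsupp (by
    rw [map_sub, map_smul, hc, smul_zero, zero_sub, neg_eq_zero]
    exact LinearMap.congr_fun (d_comp_d y M k) b)
  refine ⟨s + N, y j ^ s • b, ?_⟩
  rw [smul_sub, sub_eq_zero] at hs
  rw [map_smul, ← hs, smul_smul, pow_add]

/-- Positive-degree Čech cohomology is torsion with respect to the radical of `(y_0, …, y_{n-1})`. -/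
theorem exists_pow_smul_mem_coboundaries_of_mem_radical {x : R}
    (hx : x ∈ (Ideal.span (Set.range y)).radical) (k : ℕ) (c : Cochain y M (k + 1))
    (hc : d y M (k + 1) c = 0) : ∃ N : ℕ, x ^ N • c ∈ coboundaries y M (k + 1) := by
  -- The ideal of all `r` with `r • c` a coboundary; its radical contains every `y j`.
  let A : Ideal R := (coboundaries y M (k + 1)).comap (LinearMap.toSpanSingleton R _ c)
  have hA : Ideal.span (Set.range y) ≤ A.radical := by
    rw [Ideal.span_le]
    rintro _ ⟨j, rfl⟩
    exact exists_pow_smul_mem_coboundaries y j k c hc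
  exact Ideal.radical_le_radical_iff.2 hA hx

end Cech

/-! ### Filter regular elements: their annihilator is `𝔪`-power torsion. -/

theorem IsFilterRegular.exists_pow_smul_eq_zero {R : Type u} [CommRing R] [IsNoetherianRing R]
    [IsLocalRing R] {M : Type v} [AddCommGroup M] [Module R M] [IsNoetherian R M] {x : R}
    (hx : IsFilterRegular x M) {m : M} (hm : x • m = 0) {a : R}
    (ha : a ∈ IsLocalRing.maximalIdeal R) : ∃ N : ℕ, a ^ N • m = 0 := by
  let A : ℕ →o Ideal R :=
    ⟨fun N => LinearMap.ker (LinearMap.toSpanSingleton R M (a ^ N • m)), by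
      refine monotone_nat_of_le_succ fun N r hr => ?_
      simp only [LinearMap.mem_ker, LinearMap.toSpanSingleton_apply] at hr ⊢
      rw [pow_succ', mul_smul, smul_comm, hr, smul_zero]⟩
  -- Take `N` where the annihilators of `a^N m` stabilize. If `a^N m ≠ 0`, an associated prime of `R
  -- a^N m` contains `x`, so it is `𝔪`; it annihilates some nonzero `v = r a^N m`. Then `r` kills
  -- `a^{N+1} m`, hence `a^N m`, forcing `v = 0`.
  obtain ⟨N, hN⟩ := monotone_stabilizes_iff_noetherian.2 (inferInstance : IsNoetherian R R) A
  refine ⟨N, by_contra fun hw => ?_⟩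
  let w : Submodule.span R {a ^ N • m} := ⟨a ^ N • m, Submodule.mem_span_singleton_self _⟩
  obtain ⟨P, hP, hle⟩ := exists_le_isAssociatedPrime_of_isNoetherianRing R w
    (fun h => hw (congrArg Subtype.val h))
  have hxP : x ∈ P := hle (by
    rw [Submodule.mem_colon_singleton, Submodule.mem_bot]
    apply Subtype.ext
    change x • a ^ N • m = 0
    rw [smul_comm, hm, smul_zero])
  have hPm : P = IsLocalRing.maximalIdeal R := by_contra fun h =>
    hx.2 P (hP.map_of_injective (Submodule.subtype _) (Submodule.subtype_injective _)) h hxP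
  obtain ⟨hPp, v, hv⟩ := isAssociatedPrime_iff.1 hP
  obtain ⟨r, hr⟩ := Submodule.mem_span_singleton.1 v.2
  have hav : a • (v : M) = 0 := by
    have : a ∈ P := hPm ▸ ha
    rw [hv, Submodule.mem_colon_singleton, Submodule.mem_bot] at this
    exact congrArg Subtype.val this
  have hrA : r ∈ A (N + 1) := by
    change r • a ^ (N + 1) • m = 0
    rw [pow_succ', mul_smul, smul_comm, hr, hav]
  rw [← hN (N + 1) (Nat.le_succ N)] at hrA
  have hv0 : v = 0 := Subtype.ext (hr.symm.trans hrA)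
  apply hPp.ne_top
  rw [hv, hv0, Ideal.eq_top_iff_one, Submodule.mem_colon_singleton, smul_zero]
  exact Submodule.zero_mem _

section Comp

variable {R : Type u} [CommRing R] {n : ℕ} (y : Fin n → R)
  {M N P : Type*} [AddCommGroup M] [Module R M] [AddCommGroup N] [Module R N]
  [AddCommGroup P] [Module R P]

theorem cochainMap_cochainMap {φ ψ χ : R →+* R} (f : M →ₛₗ[φ] N) (g : N →ₛₗ[ψ] P) (h : M →ₛₗ[χ] P)
    (hφ : ∀ a, φ a ∈ Submonoid.powers a) (hψ : ∀ a, ψ a ∈ Submonoid.powers a)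
    (hχ : ∀ a, χ a ∈ Submonoid.powers a) (hR : ∀ a, ψ (φ a) = χ a) (hM : ∀ m, g (f m) = h m)
    (k : ℕ) (c : Cochain y M k) :
    cochainMap y g hψ k (cochainMap y f hφ k c) = cochainMap y h hχ k c := by
  funext σ
  change locMap g (hψ _) (locMap f (hφ _) (c σ)) = locMap h (hχ _) (c σ)
  induction c σ using LocalizedModule.induction_on with | h m s => ?_
  change LocalizedModule.mk (g (f m)) _ = LocalizedModule.mk (h m) _
  congr 1
  · exact hM m
  · exact Subtype.ext (hR s)

end Comp

/-! ### Frobenius and quotient maps on the cochains of `R/J`. -/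

section Frobenius

variable {R : Type u} [CommRing R] (p : ℕ) [Fact p.Prime] [CharP R p] {n : ℕ} (y : Fin n → R)

theorem frobPow_frobPow (I : Ideal R) (e e' : ℕ) :
    frobPow p (frobPow p I e) e' = frobPow p I (e + e') := by
  rw [frobPow, frobPow, frobPow, Ideal.map_map]
  congr 1
  ext a
  simp [iterateFrobenius_def, pow_add, pow_mul]

theorem frobPow_sup_span_singleton (I : Ideal R) (x : R) (e : ℕ) :
    frobPow p (I ⊔ Ideal.span {x}) e = frobPow p I e ⊔ Ideal.span {x ^ p ^ e} := by
  rw [frobPow, frobPow, Ideal.map_sup, Ideal.map_span, Set.image_singleton, iterateFrobenius_def]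

variable {p}

/-- The semilinear map `R/J → R/L`, `a + J ↦ a^{p^e} + L`, for `J^{[p^e]} ≤ L`. -/
def frobQuot {J L : Ideal R} {e : ℕ} (h : frobPow p J e ≤ L) :
    (R ⧸ J) →ₛₗ[iterateFrobenius R p e] (R ⧸ L) :=
  Submodule.mapQ J L (iterateFrobenius R p e).toSemilinearMap
    fun _ ha => h (Ideal.mem_map_of_mem _ ha)

/-- The map of Čech cochains induced by `frobQuot`. -/
def frobCochain {J L : Ideal R} {e : ℕ} (h : frobPow p J e ≤ L) (k : ℕ) :
    Cochain y (R ⧸ J) k →ₛₗ[iterateFrobenius R p e] Cochain y (R ⧸ L) k :=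
  cochainMap y (frobQuot h) (iterateFrobenius_mem_powers p e) k

/-- The map of Čech cochains induced by `R/J → R/L`, for `J ≤ L`. -/
def quotCochain {J L : Ideal R} (h : J ≤ L) (k : ℕ) :
    Cochain y (R ⧸ J) k →ₗ[R] Cochain y (R ⧸ L) k :=
  linCochainMap y (Submodule.factor h) k

theorem frobCochain_smul {J L : Ideal R} {e : ℕ} (h : frobPow p J e ≤ L) (k : ℕ) (a : R)
    (c : Cochain y (R ⧸ J) k) : frobCochain y h k (a • c) = a ^ p ^ e • frobCochain y h k c := by
  rw [map_smulₛₗ, iterateFrobenius_def]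

theorem frobCochain_d {J L : Ideal R} {e : ℕ} (h : frobPow p J e ≤ L) (k : ℕ)
    (c : Cochain y (R ⧸ J) k) :
    frobCochain y h (k + 1) (d y _ k c) = d y _ k (frobCochain y h k c) :=
  cochainMap_d y _ _ k c

theorem quotCochain_d {J L : Ideal R} (h : J ≤ L) (k : ℕ) (c : Cochain y (R ⧸ J) k) :
    quotCochain y h (k + 1) (d y _ k c) = d y _ k (quotCochain y h k c) :=
  linCochainMap_d y _ k c

theorem quotCochain_mem_coboundaries {J L : Ideal R} (h : J ≤ L) (k : ℕ)
    {c : Cochain y (R ⧸ J) k} (hc : c ∈ coboundaries y _ k) :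
    quotCochain y h k c ∈ coboundaries y _ k :=
  cochainMap_mem_coboundaries y _ self_mem_powers k hc

theorem frobCochain_frobCochain {J K L : Ideal R} {e e' : ℕ} (h : frobPow p J e ≤ K)
    (h' : frobPow p K e' ≤ L) (h'' : frobPow p J (e + e') ≤ L) (k : ℕ) (c : Cochain y (R ⧸ J) k) :
    frobCochain y h' k (frobCochain y h k c) = frobCochain y h'' k c := by
  have hR : ∀ a : R, iterateFrobenius R p e' (iterateFrobenius R p e a)
      = iterateFrobenius R p (e + e') a := by
    intro a
    simp [iterateFrobenius_def, pow_add, pow_mul]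
  refine cochainMap_cochainMap y _ _ _ _ _ _ hR (fun m => ?_) k c
  obtain ⟨m, rfl⟩ := Submodule.Quotient.mk_surjective J m
  exact congrArg (Submodule.Quotient.mk (p := L)) (hR m)

theorem quotCochain_frobCochain {J J' L L' : Ideal R} {e : ℕ} (h : frobPow p J e ≤ J')
    (h' : frobPow p L e ≤ L') (hJ : J ≤ L) (hJ' : J' ≤ L') (k : ℕ) (c : Cochain y (R ⧸ J) k) :
    quotCochain y hJ' k (frobCochain y h k c) = frobCochain y h' k (quotCochain y hJ k c) := by
  refine (cochainMap_cochainMap y _ _ (frobQuot (h.trans hJ')) _ self_mem_powers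
    (iterateFrobenius_mem_powers p e) (fun _ => rfl) (fun m => ?_) k c).trans
    (cochainMap_cochainMap y _ _ _ self_mem_powers _ _ (fun _ => rfl) (fun m => ?_) k c).symm <;>
  · obtain ⟨m, rfl⟩ := Submodule.Quotient.mk_surjective J m
    rfl

theorem quotCochain_surjective {J L : Ideal R} (h : J ≤ L) (k : ℕ) :
    Function.Surjective (quotCochain y h k) :=
  linCochainMap_surjective y _ (Submodule.factor_surjective h) k

theorem exists_eq_smul_of_quotCochain_eq_zero {J L : Ideal R} {u : R} (hL : J ⊔ Ideal.span {u} = L)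
    (h : J ≤ L) (k : ℕ) (c : Cochain y (R ⧸ J) k) (hc : quotCochain y h k c = 0) :
    ∃ a, c = u • a := by
  refine exists_eq_smul_of_linCochainMap_eq_zero y _ u (fun m hm => ?_) k c hc
  obtain ⟨m, rfl⟩ := Submodule.Quotient.mk_surjective J m
  have hmL : m ∈ L := (Submodule.Quotient.mk_eq_zero L).1 hm
  rw [← hL, sup_comm, Ideal.mem_span_singleton_sup] at hmL
  obtain ⟨a, b, hb, rfl⟩ := hmL
  refine ⟨Submodule.Quotient.mk a, ?_⟩
  rw [← Submodule.Quotient.mk_smul, Submodule.Quotient.eq]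
  simpa [mul_comm] using hb

theorem quotCochain_smul_eq_zero {J L : Ideal R} {u : R} (hu : u ∈ L) (h : J ≤ L) (k : ℕ)
    (c : Cochain y (R ⧸ J) k) : quotCochain y h k (u • c) = 0 := by
  rw [map_smul]
  funext σ
  change u • quotCochain y h k c σ = 0
  induction quotCochain y h k c σ using LocalizedModule.induction_on with | h m s => ?_
  obtain ⟨m, rfl⟩ := Submodule.Quotient.mk_surjective L m
  rw [LocalizedModule.smul'_mk, ← Submodule.Quotient.mk_smul,
    (Submodule.Quotient.mk_eq_zero L (x := u • m)).2 (L.mul_mem_right m hu), LocalizedModule.zero_mk]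

variable (p) in
-- Quantifying over every `L` equal to the Frobenius power lets iterated Frobenius powers be
-- rewritten without transporting cochains along equalities of ideals.
theorem isFNilpotentRel_iff (J : Ideal R) (i : ℕ) :
    IsFNilpotentRel p y J i ↔ ∀ c : Cochain y (R ⧸ J) i, d y _ i c = 0 →
      ∃ e : ℕ, ∀ (L : Ideal R) (h : frobPow p J e = L),
        frobCochain y h.le i c ∈ coboundaries y _ i := by
  have key : ∀ (c : cocycles y (R ⧸ J) i) (e : ℕ),
      relFrobH p y J e i (Submodule.Quotient.mk c) = 0 ↔
        ∀ (L : Ideal R) (h : frobPow p J e = L), frobCochain y h.le i c ∈ coboundaries y _ i := by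
    intro c e
    refine Iff.trans (b := frobCochain y (le_refl (frobPow p J e)) i c ∈ coboundaries y _ i)
      (Submodule.Quotient.mk_eq_zero _) ⟨?_, fun h => h _ rfl⟩
    rintro h _ rfl
    exact h
  constructor
  · intro h c hc
    obtain ⟨e, he⟩ := h (Submodule.Quotient.mk ⟨c, hc⟩)
    exact ⟨e, (key _ _).1 he⟩
  · intro h η
    obtain ⟨c, rfl⟩ := Submodule.Quotient.mk_surjective _ η
    obtain ⟨e, he⟩ := h c c.2
    exact ⟨e, (key _ _).2 he⟩

/-! ### Transfer of `F`-nilpotence between `R/J` and `R/(J,u)`. -/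

variable (p) in
/-- `u` is injective on the Čech cochains of positive degree of all `R/J^{[p^e]}`. -/
def IsCechRegular (J : Ideal R) (u : R) : Prop :=
  ∀ (e : ℕ) (L : Ideal R), frobPow p J e = L →
    ∀ (k : ℕ) (c : Cochain y (R ⧸ L) (k + 1)), u • c = 0 → c = 0

variable {y}

theorem frobPow_zero (J : Ideal R) : frobPow p J 0 = J := by
  rw [frobPow, iterateFrobenius_zero, Ideal.map_id]

theorem IsCechRegular.pow {J : Ideal R} {u : R} (hu : IsCechRegular p y J u) (N : ℕ) :
    IsCechRegular p y J (u ^ N) := by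
  intro e L h k c hc
  induction N with
  | zero => simpa using hc
  | succ N ih => exact ih (hu e L h k _ (by rwa [smul_smul, ← pow_succ']))

theorem IsCechRegular.frobPow {J : Ideal R} {u : R} (hu : IsCechRegular p y J u) (e : ℕ) :
    IsCechRegular p y (frobPow p J e) u := by
  intro e' L h
  rw [frobPow_frobPow] at h
  exact hu _ L h

theorem IsFNilpotentRel.sup_span_singleton {J : Ideal R} {u : R} (hu : IsCechRegular p y J u) {i : ℕ}
    (h₁ : IsFNilpotentRel p y J (i + 1)) (h₀ : ∀ e, IsFNilpotentRel p y (frobPow p J e) i) :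
    IsFNilpotentRel p y (J ⊔ Ideal.span {u}) i := by
  rw [isFNilpotentRel_iff] at h₁ ⊢
  intro c hc
  have hJL : J ≤ J ⊔ Ideal.span {u} := le_sup_left
  obtain ⟨b, rfl⟩ := quotCochain_surjective y hJL i c
  rw [← quotCochain_d] at hc
  obtain ⟨a, ha⟩ := exists_eq_smul_of_quotCochain_eq_zero y rfl hJL _ _ hc
  -- `a` represents the connecting image of the given class; it is a cocycle because `u` is
  -- injective in degree `i + 2`.
  have hda : d y _ (i + 1) a = 0 := by
    refine hu 0 J (frobPow_zero J) _ _ ?_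
    rw [← map_smul, ← ha]
    exact LinearMap.congr_fun (d_comp_d y _ i) b
  obtain ⟨e, he⟩ := h₁ a hda
  obtain ⟨g, hg⟩ := he _ rfl
  -- Since the connecting image dies under `F^e`, subtracting a multiple of `u^{p^e}` makes the lift
  -- `F^e(b)` a cocycle without changing its reduction.
  set b' := frobCochain y (le_refl (frobPow p J e)) i b - u ^ p ^ e • g with hb'
  have hdb' : d y _ i b' = 0 := by
    rw [hb', map_sub, map_smul, hg, ← frobCochain_d, ha, frobCochain_smul, sub_self]
  obtain ⟨e', he'⟩ := (isFNilpotentRel_iff p y _ i).1 (h₀ e) b' hdb'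
  refine ⟨e + e', ?_⟩
  rintro L' hL'
  have hJL' : frobPow p (frobPow p J e) e' ≤ L' := by
    rw [← hL', frobPow_frobPow]
    exact Ideal.map_mono hJL
  have h1 := quotCochain_mem_coboundaries y hJL' i (he' _ rfl)
  have hLe : frobPow p (frobPow p (J ⊔ Ideal.span {u}) e) e' ≤ L' :=
    (frobPow_frobPow p _ e e').trans hL' |>.le
  have hJLe : frobPow p J e ≤ frobPow p (J ⊔ Ideal.span {u}) e := Ideal.map_mono hJL
  have hue : u ^ p ^ e ∈ frobPow p (J ⊔ Ideal.span {u}) e := by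
    rw [frobPow_sup_span_singleton]
    exact Ideal.mem_sup_right (Ideal.mem_span_singleton_self _)
  rwa [quotCochain_frobCochain y _ hLe hJLe, hb', map_sub, quotCochain_smul_eq_zero y hue, sub_zero,
    quotCochain_frobCochain y _ le_rfl hJL, frobCochain_frobCochain y _ _ hL'.le] at h1

theorem isFNilpotentRel_succ_of_sup_span_singleton {J : Ideal R} {x : R}
    (hx : IsCechRegular p y J x) (hxy : x ∈ (Ideal.span (Set.range y)).radical) {i : ℕ}
    (h : ∀ e' : ℕ, IsFNilpotentRel p y (J ⊔ Ideal.span {x ^ p ^ e'}) i) :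
    IsFNilpotentRel p y J (i + 1) := by
  rw [isFNilpotentRel_iff]
  intro a hda
  obtain ⟨N, hN⟩ := exists_pow_smul_mem_coboundaries_of_mem_radical y hxy i a hda
  have hp : 1 < p := (Fact.out : p.Prime).one_lt
  -- The hypothesis concerns only exponents that are powers of `p`; as `N < p^N`, `x^{p^N}` kills
  -- the class too.
  obtain ⟨s, hs⟩ := Nat.exists_eq_add_of_le (Nat.lt_pow_self hp (n := N)).le
  set u := x ^ p ^ N with hu
  have hua : u • a ∈ coboundaries y _ (i + 1) := by
    rw [hu, hs, pow_add, mul_comm, mul_smul]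
    exact Submodule.smul_mem _ _ hN
  have hru : IsCechRegular p y J u := hx.pow _
  obtain ⟨b, hb⟩ := hua
  have hJL : J ≤ J ⊔ Ideal.span {u} := le_sup_left
  have huL : u ∈ J ⊔ Ideal.span {u} := Ideal.mem_sup_right (Ideal.mem_span_singleton_self _)
  obtain ⟨e, he⟩ := (isFNilpotentRel_iff p y _ i).1 (h N) (quotCochain y hJL i b) (by
    rw [← quotCochain_d, hb, quotCochain_smul_eq_zero y huL])
  refine ⟨e, ?_⟩
  rintro J' hJ'
  have hL' : frobPow p (J ⊔ Ideal.span {u}) e = J' ⊔ Ideal.span {u ^ p ^ e} := by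
    rw [frobPow_sup_span_singleton, hJ']
  have hJL' : J' ≤ J' ⊔ Ideal.span {u ^ p ^ e} := le_sup_left
  have h1 := he _ hL'
  rw [← quotCochain_frobCochain y hJ'.le _ _ hJL'] at h1
  -- A coboundary modulo `u^{p^e}` lifts to a coboundary; in degree 0 it is zero by definition.
  obtain ⟨w, hw, hdw⟩ : ∃ w ∈ coboundaries y (R ⧸ J') i,
      quotCochain y hJL' i w = quotCochain y hJL' i (frobCochain y hJ'.le i b) := by
    cases i with
    | zero => exact ⟨0, Submodule.zero_mem _, by rw [map_zero]; exact h1.symm⟩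
    | succ i =>
      obtain ⟨w, hw⟩ := h1
      obtain ⟨w, rfl⟩ := quotCochain_surjective y hJL' i w
      exact ⟨_, ⟨w, rfl⟩, by rw [quotCochain_d, hw]⟩
  obtain ⟨v, hv⟩ := exists_eq_smul_of_quotCochain_eq_zero y rfl hJL' i
    (frobCochain y hJ'.le i b - w) (by rw [map_sub, hdw, sub_self])
  have hw0 : d y _ i w = 0 := coboundaries_le y _ i hw
  -- From `F^e(b) - w = u^{p^e} v` one gets `u^{p^e} F^e(a) = u^{p^e} dv`; cancel in degree `i + 1`.
  refine ⟨v, sub_eq_zero.1 (hru.pow (p ^ e) e J' hJ' _ _ ?_)⟩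
  rw [smul_sub, ← map_smul, ← hv, map_sub, hw0, sub_zero, ← frobCochain_d, hb, frobCochain_smul,
    sub_self]

theorem isFNilpotentRel_zero_of_sup_span_singleton [IsLocalRing R] {I : Ideal R} {x : R}
    (hx : IsCechRegular p y I x) (hxm : x ∈ IsLocalRing.maximalIdeal R) (hI : SatisfiesLC p y I)
    (e : ℕ) (h : ∀ e' : ℕ, IsFNilpotentRel p y (frobPow p I e ⊔ Ideal.span {x ^ p ^ e'}) 0) :
    IsFNilpotentRel p y (frobPow p I e) 0 := by
  rw [isFNilpotentRel_iff]
  intro c hc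
  obtain ⟨C, hC⟩ := hI
  have hp : 1 < p := (Fact.out : p.Prime).one_lt
  -- `u` must be fixed before `e₁` is known. As `p^{e'} ≥ C p^e`, the power `u^{p^{e₁}}` lies in
  -- `𝔪^{C p^{e+e₁}}` for every `e₁`; this is where the linear growth in (LC) matters.
  set e' := C * p ^ e with he'
  set u := x ^ p ^ e' with hu
  have hJL : frobPow p I e ≤ frobPow p I e ⊔ Ideal.span {u} := le_sup_left
  obtain ⟨e₁, he₁⟩ := (isFNilpotentRel_iff p y _ 0).1 (h e') (quotCochain y hJL 0 c) (by
    rw [← quotCochain_d, hc, map_zero])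
  refine ⟨e₁, ?_⟩
  rintro J' hJ'
  have hJL' : J' ≤ J' ⊔ Ideal.span {u ^ p ^ e₁} := le_sup_left
  have h1 := he₁ (J' ⊔ Ideal.span {u ^ p ^ e₁}) (by rw [frobPow_sup_span_singleton, hJ'])
  rw [← quotCochain_frobCochain y hJ'.le _ _ hJL'] at h1
  obtain ⟨v, hv⟩ := exists_eq_smul_of_quotCochain_eq_zero y rfl hJL' 0 _ h1
  have hJ'I : frobPow p I (e + e₁) = J' := by rw [← frobPow_frobPow, hJ']
  -- Here `v` sits in degree 0, but `dv` lies in degree 1, where powers of `x` can be cancelled.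
  have hdv : d y _ 0 v = 0 := by
    refine (hx.pow (p ^ e')).pow (p ^ e₁) _ J' hJ'I _ _ ?_
    rw [← map_smul, ← hv, ← frobCochain_d, hc, map_zero]
  have hmem : u ^ p ^ e₁ ∈ IsLocalRing.maximalIdeal R ^ (C * p ^ (e + e₁)) := by
    rw [hu, ← pow_mul]
    refine Ideal.pow_le_pow_right ?_ (Ideal.pow_mem_pow hxm _)
    rw [pow_add, ← mul_assoc]
    exact Nat.mul_le_mul_right _ (Nat.lt_pow_self hp).le
  have hzero : ∀ η : H y (R ⧸ J') 0, u ^ p ^ e₁ • η = 0 := by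
    subst hJ'I
    exact hC _ _ hmem
  -- So (LC) kills `u^{p^{e₁}} v = F^{e₁}(c)`.
  have h2 := hzero (Submodule.Quotient.mk ⟨v, hdv⟩)
  rw [← Submodule.Quotient.mk_smul, Submodule.Quotient.mk_eq_zero] at h2
  rw [hv]
  exact h2

theorem isCechRegular_of_isFilterRegular [IsNoetherianRing R] [IsLocalRing R] {I : Ideal R} {x : R}
    (hy : ∀ j, y j ∈ IsLocalRing.maximalIdeal R)
    (hx : ∀ e : ℕ, IsFilterRegular x (R ⧸ frobPow p I e)) : IsCechRegular p y I x := by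
  rintro e _ rfl k c hc
  exact cochain_smul_injective y x (fun m hm j => (hx e).exists_pow_smul_eq_zero hm (hy j)) k c hc

end Frobenius

end LocCoh

end

theorem mainTheorem12 {R : Type*} [CommRing R] [IsNoetherianRing R] [IsLocalRing R]
    (p : ℕ) [Fact p.Prime] [CharP R p]
    {n : ℕ} (y : Fin n → R)
    (hy : (Ideal.span (Set.range y)).radical = IsLocalRing.maximalIdeal R)
    (I : Ideal R) (x : R)
    (hx : ∀ e : ℕ, LocCoh.IsFilterRegular x (R ⧸ LocCoh.frobPow p I e)) (t : ℕ) :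
    ((∀ i ≤ t, ∀ e : ℕ, LocCoh.IsFNilpotentRel p y (LocCoh.frobPow p I e) i) →
      ∀ i : ℕ, i + 1 ≤ t → ∀ e e' : ℕ,
        LocCoh.IsFNilpotentRel p y (LocCoh.frobPow p I e ⊔ Ideal.span {x ^ p ^ e'}) i) ∧
    (1 ≤ t → LocCoh.SatisfiesLC p y I →
      (∀ i : ℕ, i + 1 ≤ t → ∀ e e' : ℕ,
        LocCoh.IsFNilpotentRel p y (LocCoh.frobPow p I e ⊔ Ideal.span {x ^ p ^ e'}) i) →
      ∀ i ≤ t, ∀ e : ℕ, LocCoh.IsFNilpotentRel p y (LocCoh.frobPow p I e) i) := by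
  have hx' := LocCoh.isCechRegular_of_isFilterRegular (y := y) (fun j =>
    hy ▸ Ideal.le_radical (Ideal.subset_span (Set.mem_range_self j))) hx
  have hxy : x ∈ (Ideal.span (Set.range y)).radical := hy ▸ (hx 0).1
  refine ⟨fun h i hi e e' => ?_, fun ht hI h i hi e => ?_⟩
  · refine LocCoh.IsFNilpotentRel.sup_span_singleton ((hx'.frobPow e).pow _) (h _ hi _) fun e₁ => ?_
    rw [LocCoh.frobPow_frobPow]
    exact h _ (Nat.le_of_succ_le hi) _
  · cases i with
    | zero =>
      exact LocCoh.isFNilpotentRel_zero_of_sup_span_singleton hx' (hx 0).1 hI e (h 0 ht e)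
    | succ i =>
      exact LocCoh.isFNilpotentRel_succ_of_sup_span_singleton (hx'.frobPow e) hxy (h i hi e)
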